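/- Let $R$ be an associative ring with identity and let $M$ be a left $R$-module. A module is $M$-generated if it is a homomorphic image of a direct sum of copies of $M$, and $\sigma[M]$ is the full subcategory of left $R$-modules whose objects are the modules isomorphic to submodules of $M$-generated modules. A submodule $N\le M$ is fully invariant if $f(N)\subseteq N$ for every endomorphism $f$ of $M$. For submodules $K,L\le M$ put $K_ML=\sum\{f(K)\mid f\in\operatorname{Hom}_R(M,L)\}$. A fully invariant submodule $N\ne M$ is semiprime in $M$ if $K_MK\le N$ implies $K\le N$ for every fully invariant submodule $K$ of $M$. Let $SP(M)$ be the set consisting of $M$ and of all semiprime fully invariant submodules of $M$, ordered by inclusion. A frame is a complete lattice in which $a\wedge\bigvee X=\bigvee\{a\wedge x\mid x\in X\}$ for every element $a$ and every subset $X$; it is spatial if it is isomorphic to the frame of open sets of some topological space, and totally spatial if each of its quotient frames (the frame of fixed points of any nucleus on it) is spatial. **Theorem.** Suppose that $M$ is projective in $\sigma[M]$ and that, for every fully invariant submodule $N\le M$, the factor module $M/N$ has finite uniform dimension (it contains no infinite direct sum of nonzero submodules). Then $SP(M)$ is a frame, and this frame is totally spatial. -/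

import Mathlib

universe u v

section ModuleTheory

/-- `X` is `M`-generated: it is an epimorphic image of a direct sum of copies of `M`. -/
def IsGeneratedBy (R : Type u) (M X : Type v) [Ring R] [AddCommGroup M] [Module R M]
    [AddCommGroup X] [Module R X] : Prop :=
  ∃ (I : Type v) (g : (I →₀ M) →ₗ[R] X), Function.Surjective g

/-- `X` is subgenerated by `M`, i.e. `X` is an object of `σ[M]`: it is isomorphic to a submodule
of an `M`-generated module. -/
def IsSubgeneratedBy (R : Type u) (M X : Type v) [Ring R] [AddCommGroup M] [Module R M]
    [AddCommGroup X] [Module R X] : Prop :=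
  ∃ (Y : Type v) (_ : AddCommGroup Y) (_ : Module R Y),
    IsGeneratedBy R M Y ∧ ∃ i : X →ₗ[R] Y, Function.Injective i

/-- `M` is projective in the category `σ[M]`: every morphism from `M` lifts along every epimorphism
of `σ[M]`. Since `σ[M]` is closed under quotient modules, its epimorphisms are the surjective
linear maps. -/
def IsProjectiveInSigma (R : Type u) (M : Type v) [Ring R] [AddCommGroup M] [Module R M] : Prop :=
  ∀ (X Y : Type v) [AddCommGroup X] [Module R X] [AddCommGroup Y] [Module R Y],
    IsSubgeneratedBy R M X → IsSubgeneratedBy R M Y →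
      ∀ g : X →ₗ[R] Y, Function.Surjective g →
        ∀ f : M →ₗ[R] Y, ∃ h : M →ₗ[R] X, g ∘ₗ h = f

/-- `M` has finite uniform dimension: it contains no infinite direct sum of nonzero submodules. -/
def HasFiniteUniformDimension (R : Type u) (M : Type v) [Ring R] [AddCommGroup M] [Module R M] :
    Prop :=
  ∀ A : ℕ → Submodule R M, iSupIndep A → ∃ n, A n = ⊥

variable {R : Type u} {M : Type v} [Ring R] [AddCommGroup M] [Module R M]

/-- The product `N_M L`, the sum of all `f(N)` with `f : M → L` linear, as a submodule of `M`. -/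
def submoduleProduct (N L : Submodule R M) : Submodule R M :=
  ⨆ f : M →ₗ[R] L, N.map (L.subtype ∘ₗ f)

/-- `N` is semiprime in `M`: it is a proper fully invariant submodule, and `K_M K ≤ N` implies
`K ≤ N` for every fully invariant submodule `K`. -/
structure IsSemiprimeIn (N : Submodule R M) : Prop where
  fullyInvariant : N.IsFullyInvariant
  ne_top : N ≠ ⊤
  le_of_product_le : ∀ K : Submodule R M, K.IsFullyInvariant → submoduleProduct K K ≤ N → K ≤ N

variable (R M) in
/-- `SP(M)`: the semiprime fully invariant submodules of `M` together with `M`,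
ordered by inclusion. -/
def SP : Type v := {N : Submodule R M // IsSemiprimeIn N ∨ N = ⊤}

namespace SP

instance : PartialOrder (SP R M) := inferInstanceAs (PartialOrder (Subtype _))

theorem mem_iff (N : Submodule R M) :
    (IsSemiprimeIn N ∨ N = ⊤) ↔ N.IsFullyInvariant ∧
      ∀ K : Submodule R M, K.IsFullyInvariant → submoduleProduct K K ≤ N → K ≤ N := by
  constructor
  · rintro (h | rfl)
    · exact ⟨h.1, h.3⟩
    · exact ⟨fun _ => le_top, fun _ _ _ => le_top⟩
  · rintro ⟨h1, h2⟩
    by_cases h : N = ⊤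
    · exact Or.inr h
    · exact Or.inl ⟨h1, h, h2⟩

theorem sInf_mem (s : Set (Submodule R M)) (hs : ∀ N ∈ s, IsSemiprimeIn N ∨ N = ⊤) :
    IsSemiprimeIn (sInf s) ∨ sInf s = ⊤ := by
  rw [mem_iff]
  refine ⟨fun f => ?_, fun K hK h => le_sInf fun N hN => ?_⟩
  · rw [← Submodule.map_le_iff_le_comap]
    refine le_sInf fun N hN => ?_
    exact (Submodule.map_mono (sInf_le hN)).trans
      (Submodule.map_le_iff_le_comap.2 (((mem_iff N).1 (hs N hN)).1 f))
  · exact ((mem_iff N).1 (hs N hN)).2 K hK (h.trans (sInf_le hN))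

instance : InfSet (SP R M) :=
  ⟨fun s => ⟨sInf (Subtype.val '' s), sInf_mem _ (by rintro _ ⟨N, _, rfl⟩; exact N.2)⟩⟩

instance : Min (SP R M) :=
  ⟨fun N L => ⟨N.1 ⊓ L.1, by
    rw [← sInf_pair]
    exact sInf_mem _ (by rintro _ (rfl | rfl); exacts [N.2, L.2])⟩⟩

/-- `SP(M)` is a complete lattice under inclusion; meets are intersections. -/
instance : CompleteLattice (SP R M) where
  __ := completeLatticeOfInf (SP R M) (fun s =>
    ⟨fun N hN =>
      show sInf (Subtype.val '' s) ≤ N.1 from sInf_le (Set.mem_image_of_mem Subtype.val hN),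
     fun L hL =>
      show L.1 ≤ sInf (Subtype.val '' s) from
        le_sInf (by rintro _ ⟨N, hN, rfl⟩; exact hL hN)⟩)
  top := ⟨⊤, Or.inr rfl⟩
  le_top N := (le_top : N.1 ≤ ⊤)
  inf := (· ⊓ ·)
  inf_le_left N L := (inf_le_left : N.1 ⊓ L.1 ≤ N.1)
  inf_le_right N L := (inf_le_right : N.1 ⊓ L.1 ≤ L.1)
  le_inf N L K h1 h2 := (le_inf h1 h2 : N.1 ≤ L.1 ⊓ K.1)

end SP

end ModuleTheory

section Frames

/-- `F` is spatial: it is isomorphic to the lattice of open sets of some topological space. -/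
def IsSpatial (F : Type v) [PartialOrder F] : Prop :=
  ∃ (X : Type v) (_ : TopologicalSpace X), Nonempty (F ≃o TopologicalSpace.Opens X)

/-- The frame `F` is totally spatial: each quotient frame, i.e. the frame of fixed points of each
nucleus `j` on `F` (which is the range of `j`), is spatial. -/
def IsTotallySpatial (F : Type v) [Order.Frame F] : Prop :=
  ∀ j : Nucleus F, IsSpatial (Set.range j)

end Frames

section SemiprimeSubmodules

variable {R : Type u} {M : Type v} [Ring R] [AddCommGroup M] [Module R M]

/-! Modulo a semiprime `N`, the product of fully invariant submodules behaves like their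
intersection (`submoduleProduct_le_iff_inf_le`). Projectivity makes the product distribute over sums
on the right, so the sum of all `L` with `a_M L ≤ c` is an implication in `SP(M)`
(`exists_residual`), and distributivity follows. Finite uniform dimension of `M/a` forbids
infinitely many elements, none below `a`, with pairwise meets below `a`. This condition passes to
quotient frames, and it yields enough primes of the form `u ⇨ a` to make a frame spatial. -/

theorem submoduleProduct_le_iff {K L N : Submodule R M} :
    submoduleProduct K L ≤ N ↔ ∀ f : M →ₗ[R] L, ∀ x ∈ K, (f x : M) ∈ N := by
  rw [submoduleProduct, iSup_le_iff]
  exact forall_congr' fun _ => Submodule.map_le_iff_le_comap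

theorem apply_mem_submoduleProduct {K L : Submodule R M} (f : M →ₗ[R] L) {x : M} (hx : x ∈ K) :
    (f x : M) ∈ submoduleProduct K L :=
  submoduleProduct_le_iff.1 le_rfl f x hx

theorem submoduleProduct_mono {K K' L L' : Submodule R M} (hK : K ≤ K') (hL : L ≤ L') :
    submoduleProduct K L ≤ submoduleProduct K' L' :=
  submoduleProduct_le_iff.2 fun f _ hx =>
    apply_mem_submoduleProduct (Submodule.inclusion hL ∘ₗ f) (hK hx)

theorem submoduleProduct_le_right (K L : Submodule R M) : submoduleProduct K L ≤ L :=
  submoduleProduct_le_iff.2 fun f x _ => (f x).2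

theorem Submodule.IsFullyInvariant.submoduleProduct_le {K : Submodule R M}
    (hK : K.IsFullyInvariant) (L : Submodule R M) : submoduleProduct K L ≤ K :=
  submoduleProduct_le_iff.2 fun f _ hx => hK (L.subtype ∘ₗ f) hx

theorem Submodule.IsFullyInvariant.inf {K L : Submodule R M} (hK : K.IsFullyInvariant)
    (hL : L.IsFullyInvariant) : (K ⊓ L).IsFullyInvariant :=
  fun f _ hx => ⟨hK f hx.1, hL f hx.2⟩

theorem Submodule.IsFullyInvariant.sSup {s : Set (Submodule R M)}
    (hs : ∀ K ∈ s, K.IsFullyInvariant) : (sSup s).IsFullyInvariant :=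
  fun f => sSup_le fun K hK => (hs K hK f).trans (Submodule.comap_mono (le_sSup hK))

/-- If `M` is projective in `σ[M]`, the product of submodules distributes over suprema in its
second argument. -/
theorem submoduleProduct_sSup_le (hproj : IsProjectiveInSigma R M) (K N : Submodule R M)
    (s : Set (Submodule R M)) (h : ∀ L ∈ s, submoduleProduct K L ≤ N) :
    submoduleProduct K (sSup s) ≤ N := by
  classical
  -- `D` is the direct sum of the members of `s`. A map from `M` to their sum lifts to `D`, and each
  -- component of the lift lands in a single member.
  let D : Submodule R (s →₀ M) := ⨅ i : s, i.1.comap (Finsupp.lapply i)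
  have hD (x : s →₀ M) : x ∈ D ↔ ∀ i : s, x i ∈ i.1 := by simp [D]
  have hgen (X : Submodule R (s →₀ M)) : IsSubgeneratedBy R M X :=
    ⟨s →₀ M, inferInstance, inferInstance, ⟨s, LinearMap.id, Function.surjective_id⟩,
      X.subtype, X.injective_subtype⟩
  have hsub : IsSubgeneratedBy R M (sSup s : Submodule R M) :=
    ⟨M, inferInstance, inferInstance,
      ⟨PUnit, Finsupp.lapply PUnit.unit, fun x => ⟨Finsupp.single PUnit.unit x, by simp⟩⟩,
      (sSup s).subtype, (sSup s).injective_subtype⟩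
  let σ : (s →₀ M) →ₗ[R] M := Finsupp.lsum ℕ fun _ => LinearMap.id
  have hσ (x : s →₀ M) : σ x = x.sum fun _ m => m := rfl
  have hσD (x : D) : σ x.1 ∈ sSup s := by
    rw [hσ]
    exact Submodule.sum_mem _ fun i _ => le_sSup i.2 ((hD _).1 x.2 i)
  let g : D →ₗ[R] (sSup s : Submodule R M) := (σ ∘ₗ D.subtype).codRestrict _ hσD
  have hg : Function.Surjective g := by
    have hle : sSup s ≤ D.map σ := by
      refine sSup_le fun L hL x hx => ⟨Finsupp.single ⟨L, hL⟩ x, (hD _).2 fun i => ?_, ?_⟩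
      · rw [Finsupp.single_apply]
        split_ifs with hi
        · subst hi
          exact hx
        · exact i.1.zero_mem
      · simp [hσ]
    rintro ⟨x, hx⟩
    obtain ⟨d, hd, rfl⟩ := hle hx
    exact ⟨⟨d, hd⟩, rfl⟩
  refine submoduleProduct_le_iff.2 fun f x hx => ?_
  obtain ⟨φ, rfl⟩ := hproj _ _ (hgen D) hsub g hg f
  change σ (φ x).1 ∈ N
  rw [hσ]
  refine Submodule.sum_mem _ fun i _ => h i.1 i.2 ?_
  exact apply_mem_submoduleProduct
    ((Finsupp.lapply i ∘ₗ D.subtype ∘ₗ φ).codRestrict i.1 fun y => (hD _).1 (φ y).2 i) hx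

namespace SP

theorem isFullyInvariant (N : SP R M) : N.1.IsFullyInvariant :=
  ((mem_iff N.1).1 N.2).1

theorem le_of_submoduleProduct_self_le (N : SP R M) {K : Submodule R M}
    (hK : K.IsFullyInvariant) (h : submoduleProduct K K ≤ N.1) : K ≤ N.1 :=
  ((mem_iff N.1).1 N.2).2 K hK h

/-- The square of `K ⊓ L` lies in `K_M L`, which in turn lies in `K ⊓ L`; semiprimeness removes the
square. -/
theorem submoduleProduct_le_iff_inf_le (N : SP R M) {K L : Submodule R M}
    (hK : K.IsFullyInvariant) (hL : L.IsFullyInvariant) :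
    submoduleProduct K L ≤ N.1 ↔ K ⊓ L ≤ N.1 :=
  ⟨fun h => N.le_of_submoduleProduct_self_le (hK.inf hL)
    ((submoduleProduct_mono inf_le_left inf_le_right).trans h),
  (le_inf (hK.submoduleProduct_le L) (submoduleProduct_le_right K L)).trans⟩

/-- The largest fully invariant submodule `L` with `a_M L ≤ c` is semiprime or `M`. -/
theorem exists_residual (hproj : IsProjectiveInSigma R M) (a c : SP R M) :
    ∃ d : SP R M, ∀ b : SP R M, b ≤ d ↔ a ⊓ b ≤ c := by
  let s : Set (Submodule R M) := {L | L.IsFullyInvariant ∧ submoduleProduct a.1 L ≤ c.1}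
  have hs : (sSup s).IsFullyInvariant := Submodule.IsFullyInvariant.sSup fun _ hL => hL.1
  have hprod : submoduleProduct a.1 (sSup s) ≤ c.1 :=
    submoduleProduct_sSup_le hproj _ _ s fun _ hL => hL.2
  have ha := a.isFullyInvariant
  have key (K : Submodule R M) (hK : K.IsFullyInvariant)
      (h : submoduleProduct K K ≤ sSup s) : K ≤ sSup s := by
    refine le_sSup ⟨hK, (c.submoduleProduct_le_iff_inf_le ha hK).2 ?_⟩
    -- The square of `a ⊓ K` lies in both `a` and `K_M K`, hence in `a ⊓ sSup s ≤ c`.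
    refine c.le_of_submoduleProduct_self_le (ha.inf hK) ?_
    refine (le_inf (submoduleProduct_le_right _ _ |>.trans inf_le_left)
      ((submoduleProduct_mono inf_le_right inf_le_right).trans h)).trans ?_
    exact (c.submoduleProduct_le_iff_inf_le ha hs).1 hprod
  refine ⟨⟨sSup s, (mem_iff _).2 ⟨hs, key⟩⟩, fun b => ⟨fun hb => ?_, fun hb => ?_⟩⟩
  · exact (inf_le_inf_left a.1 (show b.1 ≤ sSup s from hb)).trans
      ((c.submoduleProduct_le_iff_inf_le ha hs).1 hprod)
  · exact show b.1 ≤ sSup s from le_sSup ⟨b.isFullyInvariant,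
      (c.submoduleProduct_le_iff_inf_le ha b.isFullyInvariant).2 hb⟩

theorem inf_sSup_le_iSup_inf (hproj : IsProjectiveInSigma R M) (a : SP R M)
    (s : Set (SP R M)) : a ⊓ sSup s ≤ ⨆ b ∈ s, a ⊓ b := by
  obtain ⟨d, hd⟩ := exists_residual hproj a (⨆ b ∈ s, a ⊓ b)
  rw [← hd]
  exact sSup_le fun b hb => (hd b).2 (le_iSup₂_of_le b hb le_rfl)

end SP

end SemiprimeSubmodules

section SpatialFrames

/-- For every element `a` of the frame, there is no infinite sequence of elements not below `a`
whose pairwise meets are below `a`. -/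
def NoInfiniteDisjointSequence (F : Type v) [Order.Frame F] : Prop :=
  ∀ (a : F) (b : ℕ → F), (∀ i j, i ≠ j → b i ⊓ b j ≤ a) → ∃ n, b n ≤ a

variable {F : Type v} [Order.Frame F]

/-- The point of a frame given by a prime element. -/
def pointOfPrime (p : F) (hp : p ≠ ⊤) (h : ∀ x y, x ⊓ y ≤ p → x ≤ p ∨ y ≤ p) : Locale.PT F where
  toFun x := ¬ x ≤ p
  map_inf' x y := propext
    ⟨fun hxy => ⟨fun hx => hxy (inf_le_left.trans hx), fun hy => hxy (inf_le_right.trans hy)⟩,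
      fun hxy hi => (h x y hi).elim hxy.1 hxy.2⟩
  map_top' := propext ⟨fun _ => trivial, fun _ ht => hp (top_le_iff.1 ht)⟩
  map_sSup' s := by
    simp only [sSup_le_iff, sSup_Prop_eq, Set.exists_mem_image, not_forall, exists_prop]

/-- A frame in which every element is a meet of primes is spatial. -/
theorem isSpatial_of_exists_prime
    (h : ∀ a x : F, ¬ x ≤ a →
      ∃ p, a ≤ p ∧ ¬ x ≤ p ∧ ∀ y z, y ⊓ z ≤ p → y ≤ p ∨ z ≤ p) : IsSpatial F := by
  refine ⟨Locale.PT F, inferInstance, ⟨?_⟩⟩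
  let φ : F → TopologicalSpace.Opens (Locale.PT F) :=
    fun u => ⟨Locale.openOfElementHom F u, u, rfl⟩
  have hφ (x a : F) : φ x ≤ φ a ↔ x ≤ a := by
    constructor
    · intro hle
      by_contra hx
      obtain ⟨p, hap, hxp, hp⟩ := h a x hx
      have hmem : pointOfPrime p (fun ht => hxp (ht ▸ le_top)) hp ∈ φ x := hxp
      exact hle hmem hap
    · intro hxa q hq
      exact OrderHomClass.mono q hxa hq
  refine RelIso.ofSurjective (OrderEmbedding.ofMapLEIff φ hφ) ?_
  rintro ⟨U, u, hu⟩
  exact ⟨u, TopologicalSpace.Opens.ext hu⟩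

/-- Otherwise every element below `x` and not below `a` splits into two such pieces `v`, `w` meeting
below `a`. Splitting `w` again and again, the pieces `v` form a forbidden sequence. -/
theorem NoInfiniteDisjointSequence.exists_uniform (hF : NoInfiniteDisjointSequence F) (a x : F)
    (hx : ¬ x ≤ a) :
    ∃ u ≤ x, ¬ u ≤ a ∧ ∀ v w, v ≤ u → w ≤ u → v ⊓ w ≤ a → v ≤ a ∨ w ≤ a := by
  by_contra! hcon
  have step (u : {u : F // u ≤ x ∧ ¬ u ≤ a}) : ∃ v w : {u : F // u ≤ x ∧ ¬ u ≤ a},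
      v.1 ≤ u.1 ∧ w.1 ≤ u.1 ∧ v.1 ⊓ w.1 ≤ a := by
    obtain ⟨v, w, hv, hw, hvw, hva, hwa⟩ := hcon u.1 u.2.1 u.2.2
    exact ⟨⟨v, hv.trans u.2.1, hva⟩, ⟨w, hw.trans u.2.1, hwa⟩, hv, hw, hvw⟩
  choose v w hv hw hvw using step
  let s (n : ℕ) := w^[n] ⟨x, le_rfl, hx⟩
  have hs (n : ℕ) : s (n + 1) = w (s n) := Function.iterate_succ_apply' _ _ _
  have hanti : Antitone fun n => (s n).1 := antitone_nat_of_succ_le fun n => by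
    simp only [hs]
    exact hw _
  have hlt (i j : ℕ) (hij : i < j) : (v (s i)).1 ⊓ (v (s j)).1 ≤ a := by
    have h1 : (v (s j)).1 ≤ (w (s i)).1 := by
      rw [← hs]
      exact (hv _).trans (hanti hij)
    exact (inf_le_inf_left _ h1).trans (hvw _)
  obtain ⟨n, hn⟩ := hF a (fun n => (v (s n)).1) fun i j hij =>
    hij.lt_or_gt.elim (hlt i j) fun h => inf_comm (v (s i)).1 _ ▸ hlt j i h
  exact (v (s n)).2.2 hn

theorem NoInfiniteDisjointSequence.isSpatial (hF : NoInfiniteDisjointSequence F) :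
    IsSpatial F := by
  refine isSpatial_of_exists_prime fun a x hx => ?_
  obtain ⟨u, hux, hua, hu⟩ := hF.exists_uniform a x hx
  -- Uniformity of `u` over `a` is exactly what makes `u ⇨ a` prime.
  refine ⟨u ⇨ a, le_himp, fun h => hua ?_, fun y z hyz => ?_⟩
  · simpa using le_himp_iff.1 (hux.trans h)
  · rw [le_himp_iff] at hyz
    simp only [le_himp_iff]
    refine hu _ _ inf_le_right inf_le_right ?_
    rwa [← inf_inf_distrib_right]

/-- The disjointness condition passes to every quotient frame. -/
theorem NoInfiniteDisjointSequence.range (hF : NoInfiniteDisjointSequence F) (j : Nucleus F) :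
    NoInfiniteDisjointSequence (Set.range j) := fun a b hab => by
  refine hF a.1 (fun n => (b n).1) fun m n hmn => ?_
  -- The inclusion of the fixed points is a right adjoint, so meets there are meets in `F`.
  rw [← j.giRestrict.gc.u_inf]
  exact hab m n hmn

theorem NoInfiniteDisjointSequence.isTotallySpatial (hF : NoInfiniteDisjointSequence F) :
    IsTotallySpatial F := fun j => (hF.range j).isSpatial

end SpatialFrames

section UniformDimension

variable {R : Type u} {M : Type v} [Ring R] [AddCommGroup M] [Module R M]

theorem SP.noInfiniteDisjointSequence
    (hframe : ∀ (a : SP R M) (s : Set (SP R M)), a ⊓ sSup s ≤ ⨆ b ∈ s, a ⊓ b)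
    (hdim : ∀ N : Submodule R M, N.IsFullyInvariant → HasFiniteUniformDimension R (M ⧸ N)) :
    @NoInfiniteDisjointSequence (SP R M) (Order.Frame.ofMinimalAxioms ⟨hframe⟩) := by
  let : Order.Frame (SP R M) := Order.Frame.ofMinimalAxioms ⟨hframe⟩
  intro a b hab
  let π := a.1.mkQ
  have hind : iSupIndep fun n => (b n).1.map π := by
    intro i
    rw [Submodule.disjoint_def]
    intro x hxi hx
    -- The join in `SP(M)` may exceed the sum of submodules, but containing it suffices. Joining `a`
    -- absorbs the choice of coset representatives.
    let t : SP R M := (⨆ (k) (_ : k ≠ i), b k) ⊔ a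
    have hsup : ⨆ (k) (_ : k ≠ i), (b k).1.map π ≤ t.1.map π :=
      iSup₂_le fun k hk => Submodule.map_mono
        (show b k ≤ t from le_sup_of_le_left (le_iSup₂_of_le k hk le_rfl))
    obtain ⟨y, hy, rfl⟩ := hxi
    obtain ⟨z, hz, hzy⟩ := hsup hx
    have hyt : y ∈ t.1 := by
      have hyz : y - z ∈ a.1 := by
        rw [← Submodule.ker_mkQ a.1, LinearMap.sub_mem_ker_iff]
        exact hzy.symm
      have : y - z ∈ t.1 := (show a ≤ t from le_sup_right) hyz
      simpa using t.1.add_mem this hz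
    have hle : b i ⊓ t ≤ a := by
      rw [inf_sup_left, inf_iSup₂_eq]
      exact sup_le (iSup₂_le fun k hk => hab i k hk.symm) inf_le_right
    exact (Submodule.Quotient.mk_eq_zero _).2 (hle (show y ∈ (b i ⊓ t).1 from ⟨hy, hyt⟩))
  obtain ⟨n, hn⟩ := hdim a.1 a.isFullyInvariant _ hind
  refine ⟨n, show (b n).1 ≤ a.1 from ?_⟩
  intro x hx
  exact (Submodule.Quotient.mk_eq_zero _).1
    ((Submodule.mem_bot R).1 (hn.le (Submodule.mem_map_of_mem hx)))

end UniformDimension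

theorem mainTheorem4 (R : Type u) (M : Type v) [Ring R] [AddCommGroup M] [Module R M]
    (hproj : IsProjectiveInSigma R M)
    (hdim : ∀ N : Submodule R M, N.IsFullyInvariant → HasFiniteUniformDimension R (M ⧸ N)) :
    ∃ hframe : ∀ (a : SP R M) (s : Set (SP R M)), a ⊓ sSup s ≤ ⨆ b ∈ s, a ⊓ b,
      @IsTotallySpatial (SP R M) (Order.Frame.ofMinimalAxioms ⟨hframe⟩) := by
  have hframe := SP.inf_sSup_le_iSup_inf (R := R) (M := M) hproj
  let : Order.Frame (SP R M) := Order.Frame.ofMinimalAxioms ⟨hframe⟩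
  exact ⟨hframe, (SP.noInfiniteDisjointSequence hframe hdim).isTotallySpatial⟩
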